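/- Proposition (third moment of the Zagreb index of PORTs). Let $T_n$ ($n\ge 1$) be a plain-oriented recursive tree (PORT) at time $n$, i.e. a random tree on the vertices $1,\dots,n$ grown as follows: $T_1$ is a single vertex, $T_2$ is a single edge, and for $n\ge 3$ the tree $T_n$ is obtained from $T_{n-1}$ by joining a new vertex $n$ by an edge to a vertex $v$ of $T_{n-1}$ that is chosen at random, given $T_{n-1}$, with probability $\deg(v)/\sum_{u}\deg(u)$ (degrees in $T_{n-1}$). Let $Z_n=\sum_{j=1}^n D_{n,j}^2$ be its Zagreb index, where $D_{n,j}$ is the degree of vertex $j$ in $T_n$, and let $\gamma$ be Euler's constant. Then there is a constant $C$ such that for all $n\ge 2$ $$\Bigl|E[Z_n^3]-(n+1)n(n-1)\bigl(8\log^3 n+24\gamma\log^2 n\bigr)\Bigr|\le C\,(n+1)n(n-1)\log n ,$$ that is, $E[Z_n^3]=(n+1)n(n-1)\bigl(8\log^3 n+24\gamma\log^2 n+O(\log n)\bigr)$. Moreover, $Z_n^3/(n\log n)^3\to 8$ in $L_1$ as $n\to\infty$. -/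

import Mathlib

open MeasureTheory ProbabilityTheory Filter Topology
open scoped ENNReal

noncomputable section

namespace PORT

open Classical in
/-- The Zagreb index of a finite graph: the sum of the squared degrees of its vertices. -/
def zagreb {V : Type*} [Fintype V] (G : SimpleGraph V) : ℕ :=
  ∑ v : V, G.degree v ^ 2

open Classical in
/-- The preferential-attachment weight of a vertex: its degree. In a graph without edges (for
PORTs, only the tree with a single vertex) every vertex gets the weight `1`, so that the unique
vertex of the one-vertex tree is chosen with probability `1`. -/
def weight {V : Type*} [Fintype V] (G : SimpleGraph V) (v : V) : ℝ≥0∞ :=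
  if G = ⊥ then 1 else (G.degree v : ℝ≥0∞)

theorem weight_sum_ne_zero {V : Type*} [Fintype V] [Nonempty V] (G : SimpleGraph V) :
    ∑' v, weight G v ≠ 0 := by
  classical
  intro h
  rw [ENNReal.tsum_eq_zero] at h
  by_cases hG : G = ⊥
  · obtain ⟨v⟩ := ‹Nonempty V›
    have := h v
    simp [weight, hG] at this
  · apply hG
    ext v w
    simp only [SimpleGraph.bot_adj, iff_false]
    intro hvw
    have h1 := h v
    simp only [weight, if_neg hG, Nat.cast_eq_zero] at h1
    have h2 := (G.degree_pos_iff_exists_adj v).2 ⟨w, hvw⟩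
    have h3 : 0 < 0 := by
      convert h2
      exact h1.symm
    exact lt_irrefl _ h3

theorem weight_sum_ne_top {V : Type*} [Fintype V] (G : SimpleGraph V) :
    ∑' v, weight G v ≠ ∞ := by
  rw [tsum_fintype]
  refine ENNReal.sum_ne_top.2 fun v _ => ?_
  unfold weight
  split_ifs
  · exact ENNReal.one_ne_top
  · exact ENNReal.natCast_ne_top _

/-- The random parent of the newcomer: the vertex `v` is chosen with probability
`deg v / ∑ u, deg u`. -/
def parentPMF {V : Type*} [Fintype V] [Nonempty V] (G : SimpleGraph V) : PMF V :=
  PMF.normalize (weight G) (weight_sum_ne_zero G) (weight_sum_ne_top G)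

/-- Attach a new vertex (the last one) to the vertex `v` of `G` by an edge. -/
def attach {n : ℕ} (G : SimpleGraph (Fin n)) (v : Fin n) : SimpleGraph (Fin (n + 1)) :=
  G.map Fin.castSuccEmb ⊔ SimpleGraph.edge v.castSucc (Fin.last n)

/-- The law of the plain-oriented recursive tree (PORT) at time `n`, a random tree on `n`
vertices labelled in the order of their appearance. At time `1` it is a single vertex, and at
each later time a newcomer is attached to a parent chosen at random in the current tree with
probability proportional to its degree. (The value at `n = 0` is the empty graph, a convention.) -/
def portPMF : (n : ℕ) → PMF (SimpleGraph (Fin n))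
  | 0 => PMF.pure ⊥
  | 1 => PMF.pure ⊥
  | n + 2 => (portPMF (n + 1)).bind fun G => (parentPMF G).map (attach G)

end PORT

end

/-! Write `S_k` for the sum of `k`-th powers of the degrees, so that the Zagreb index is `Z = S_2`,
and let `m = n - 1` be the number of edges. Attaching a leaf to a vertex of degree `d` raises `S_k`
by `(d+1)^k - d^k + 1`. The parent has degree bias `d / (2m)`, so averaging `d^j` gives `S_{j+1} /
(2m)`. Hence the means of `S_2`, `S_3`, `S_4`, `S_2^2`, `S_2 S_3`, `S_2^3` satisfy a closed
triangular system of linear recursions in `m`.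

The mean of `Z` is exactly `2 m H_m`. For the terms containing `S_3` or `S_4`, crude power bounds
suffice. Dividing the recursions for `Z^2` and `Z^3` by their homogeneous solutions `m(m+1)` and
`m(m+1)(m+2)` and summing increments gives the leading terms `4 H_m^2` and `8 H_m^3`, with errors
`O(1)` and `O(H_m)` (`exists_abs_mean_sq_sub_le`, `exists_abs_mean_cube_sub_le`). Substituting `H_m
= log n + γ + O(1/n)` produces the expansion with its `γ` term.

For the `L_1` limit, put `X = Z / (n log n)`. Its first three moments tend to 2, 4, 8, so `E
(X-2)^2` tends to 0, and `abs_cube_sub_eight_le` bounds `|X^3 - 8|` by quantities whose means are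
controlled by these moments. The limit is a constant, so only the law of each tree matters, not a
coupling between times. -/

noncomputable section

namespace PORT

/-! ### Power sums of degrees -/

section Degrees

variable {V : Type*} [Fintype V]

open Classical in
/-- The sum of the `k`-th powers of the degrees, as a real number. -/
def powSum (k : ℕ) (G : SimpleGraph V) : ℝ :=
  ∑ v : V, (G.degree v : ℝ) ^ k

open Classical in
/-- The degree of a vertex, as a real number. -/
def rdeg (G : SimpleGraph V) (v : V) : ℝ := (G.degree v : ℝ)

theorem powSum_eq (k : ℕ) (G : SimpleGraph V) : powSum k G = ∑ v, rdeg G v ^ k := rfl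

theorem powSum_nonneg (k : ℕ) (G : SimpleGraph V) : 0 ≤ powSum k G :=
  Finset.sum_nonneg fun _ _ => pow_nonneg (Nat.cast_nonneg _) _

theorem cast_zagreb (G : SimpleGraph V) : (zagreb G : ℝ) = powSum 2 G := by
  simp [zagreb, powSum]

theorem rdeg_bot (v : V) : rdeg (⊥ : SimpleGraph V) v = 0 := by
  classical
  simp [rdeg]

end Degrees

/-! ### Effect of attaching a leaf -/

section Attach

variable {n : ℕ} (G : SimpleGraph (Fin n)) (v : Fin n)

theorem attach_adj_castSucc (u w : Fin n) :
    (attach G v).Adj u.castSucc w.castSucc ↔ G.Adj u w := by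
  rw [attach, SimpleGraph.sup_adj, SimpleGraph.edge_adj,
    show u.castSucc = Fin.castSuccEmb u from rfl, show w.castSucc = Fin.castSuccEmb w from rfl,
    SimpleGraph.map_adj_apply]
  simp [(Fin.castSucc_lt_last _).ne]

theorem attach_adj_last (u : Fin n) :
    (attach G v).Adj u.castSucc (Fin.last n) ↔ u = v := by
  have h : ¬ (G.map Fin.castSuccEmb).Adj u.castSucc (Fin.last n) := by
    rw [SimpleGraph.map_adj]
    rintro ⟨a, b, -, -, hb⟩
    exact (Fin.castSucc_lt_last b).ne hb
  rw [attach, SimpleGraph.sup_adj, SimpleGraph.edge_adj]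
  simp only [h, false_or]
  simp [(Fin.castSucc_lt_last _).ne]

theorem rdeg_eq_sum {V : Type*} [Fintype V] (G : SimpleGraph V) (v : V)
    [DecidablePred (G.Adj v)] : rdeg G v = ∑ w, if G.Adj v w then (1 : ℝ) else 0 := by
  classical
  rw [rdeg, Finset.sum_boole, ← SimpleGraph.card_neighborFinset_eq_degree]
  congr 2
  ext w
  simp

theorem rdeg_attach_castSucc (u : Fin n) :
    rdeg (attach G v) u.castSucc = rdeg G u + if u = v then 1 else 0 := by
  classical
  rw [rdeg_eq_sum, rdeg_eq_sum, Fin.sum_univ_castSucc]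
  simp only [attach_adj_castSucc, attach_adj_last]

theorem rdeg_attach_last : rdeg (attach G v) (Fin.last n) = 1 := by
  classical
  rw [rdeg_eq_sum, Fin.sum_univ_castSucc]
  simp only [SimpleGraph.adj_comm _ (Fin.last n) _, attach_adj_last]
  simp

/-- Only the parent changes its degree, by one; the final `+ 1` is the newcomer, a leaf. -/
theorem powSum_attach (k : ℕ) : powSum k (attach G v) =
    powSum k G + ((rdeg G v + 1) ^ k - rdeg G v ^ k) + 1 := by
  classical
  rw [powSum_eq, powSum_eq, Fin.sum_univ_castSucc, rdeg_attach_last, one_pow]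
  congr 1
  have h : ∀ u, rdeg (attach G v) u.castSucc ^ k =
      rdeg G u ^ k + if u = v then ((rdeg G v + 1) ^ k - rdeg G v ^ k) else 0 := by
    intro u
    rw [rdeg_attach_castSucc]
    split_ifs with h
    · subst h; ring
    · simp
  simp only [h, Finset.sum_add_distrib, Finset.sum_ite_eq', Finset.mem_univ, if_true]

end Attach

/-! ### Averages over the degree-biased parent -/

section Parent

variable {V : Type*} [Fintype V] [Nonempty V] (G : SimpleGraph V)

theorem sum_parentPMF : ∑ v, (parentPMF G v).toReal = 1 := by
  rw [← ENNReal.toReal_sum fun v _ => PMF.apply_ne_top _ _, ← tsum_fintype (L := .unconditional _),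
    PMF.tsum_coe, ENNReal.toReal_one]

theorem parentPMF_toReal (hG : powSum 1 G ≠ 0) (v : V) :
    (parentPMF G v).toReal = rdeg G v / powSum 1 G := by
  have hbot : G ≠ ⊥ := by
    rintro rfl
    simp [powSum_eq, rdeg_bot] at hG
  rw [parentPMF, PMF.normalize_apply, tsum_fintype, ENNReal.toReal_mul, ENNReal.toReal_inv,
    ENNReal.toReal_sum fun v _ => by simp [weight, hbot]]
  simp [weight, hbot, powSum_eq, rdeg, div_eq_mul_inv]

/-- The conditional mean of a cubic polynomial in the degree of the random parent. -/
theorem sum_parentPMF_mul_cubic (hG : powSum 1 G ≠ 0) (a₀ a₁ a₂ a₃ : ℝ) :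
    ∑ v, (parentPMF G v).toReal *
      (a₀ + a₁ * rdeg G v + a₂ * rdeg G v ^ 2 + a₃ * rdeg G v ^ 3) =
    a₀ + (a₁ * powSum 2 G + a₂ * powSum 3 G + a₃ * powSum 4 G) / powSum 1 G := by
  have h : ∀ v, (parentPMF G v).toReal *
      (a₀ + a₁ * rdeg G v + a₂ * rdeg G v ^ 2 + a₃ * rdeg G v ^ 3) =
      a₀ * (parentPMF G v).toReal + (a₁ / powSum 1 G) * rdeg G v ^ 2 +
      (a₂ / powSum 1 G) * rdeg G v ^ 3 + (a₃ / powSum 1 G) * rdeg G v ^ 4 := by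
    intro v
    rw [parentPMF_toReal G hG]
    ring
  simp only [h, Finset.sum_add_distrib, ← Finset.mul_sum, sum_parentPMF, ← powSum_eq]
  ring

end Parent

/-! ### Expectations under the PORT law -/

section Mean

theorem sum_bind_mul {α β : Type*} [Fintype α] [Fintype β] (p : PMF α) (q : α → PMF β)
    (f : β → ℝ) : ∑ b, (p.bind q b).toReal * f b =
      ∑ a, (p a).toReal * ∑ b, (q a b).toReal * f b := by
  simp only [PMF.bind_apply, tsum_fintype, Finset.mul_sum]
  rw [Finset.sum_comm]
  refine Finset.sum_congr rfl fun b _ => ?_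
  rw [ENNReal.toReal_sum fun a _ => ENNReal.mul_ne_top (PMF.apply_ne_top _ _)
    (PMF.apply_ne_top _ _), Finset.sum_mul]
  simp [mul_assoc]

theorem sum_map_mul {α β : Type*} [Fintype α] [Fintype β] (p : PMF α) (g : α → β)
    (f : β → ℝ) : ∑ b, (p.map g b).toReal * f b = ∑ a, (p a).toReal * f (g a) := by
  classical
  rw [← PMF.bind_pure_comp, sum_bind_mul]
  refine Finset.sum_congr rfl fun a _ => ?_
  simp [PMF.pure_apply, apply_ite ENNReal.toReal]

open Classical in
/-- The mean of a functional of the PORT with `m` edges. -/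
def mean (m : ℕ) (f : SimpleGraph (Fin (m + 1)) → ℝ) : ℝ :=
  ∑ G, (portPMF (m + 1) G).toReal * f G

theorem mean_zero (f : SimpleGraph (Fin 1) → ℝ) : mean 0 f = f ⊥ := by
  classical
  simp [mean, portPMF, PMF.pure_apply, apply_ite ENNReal.toReal]

theorem mean_succ (m : ℕ) (f : SimpleGraph (Fin (m + 2)) → ℝ) :
    mean (m + 1) f = mean m fun G => ∑ v, (parentPMF G v).toReal * f (attach G v) := by
  classical
  simp only [mean, portPMF]
  rw [sum_bind_mul]
  simp only [sum_map_mul]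

theorem mean_add (m : ℕ) (f g : SimpleGraph (Fin (m + 1)) → ℝ) :
    mean m (fun G => f G + g G) = mean m f + mean m g := by
  simp [mean, mul_add, Finset.sum_add_distrib]

theorem mean_const_mul (m : ℕ) (c : ℝ) (f : SimpleGraph (Fin (m + 1)) → ℝ) :
    mean m (fun G => c * f G) = c * mean m f := by
  simp only [mean, Finset.mul_sum]
  exact Finset.sum_congr rfl fun _ _ => by ring

theorem mean_const (m : ℕ) (c : ℝ) : mean m (fun _ => c) = c := by
  classical
  rw [mean, ← Finset.sum_mul, ← ENNReal.toReal_sum fun v _ => PMF.apply_ne_top _ _,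
    ← tsum_fintype (L := .unconditional _), PMF.tsum_coe, ENNReal.toReal_one, one_mul]

theorem mean_nonneg (m : ℕ) (f : SimpleGraph (Fin (m + 1)) → ℝ) (hf : ∀ G, 0 ≤ f G) :
    0 ≤ mean m f :=
  Finset.sum_nonneg fun G _ => mul_nonneg ENNReal.toReal_nonneg (hf G)

/-- A PORT with `m` edges has degree sum `2 m`. -/
theorem powSum_one_of_ne_zero (m : ℕ) (G : SimpleGraph (Fin (m + 1)))
    (hG : portPMF (m + 1) G ≠ 0) : powSum 1 G = 2 * m := by
  induction m with
  | zero =>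
    have : G = ⊥ := by
      by_contra h
      simp [portPMF, PMF.pure_apply, h] at hG
    subst this
    simp [powSum_eq, rdeg_bot]
  | succ m ih =>
    rw [← PMF.mem_support_iff, portPMF, PMF.mem_support_bind_iff] at hG
    obtain ⟨H, hH, hG⟩ := hG
    rw [PMF.mem_support_map_iff] at hG
    obtain ⟨v, -, rfl⟩ := hG
    rw [powSum_attach, ih H hH]
    push_cast
    ring

/-- The degree sum is deterministic on the support of the law, which makes the denominator of the
parent probabilities a constant. -/
theorem mean_congr (m : ℕ) {f g : SimpleGraph (Fin (m + 1)) → ℝ}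
    (h : ∀ G, powSum 1 G = 2 * m → f G = g G) : mean m f = mean m g := by
  refine Finset.sum_congr rfl fun G _ => ?_
  by_cases hG : portPMF (m + 1) G = 0
  · simp [hG]
  · rw [h G (powSum_one_of_ne_zero m G hG)]

/-- One growth step for a functional that is a cubic polynomial in the degree of the parent. -/
theorem mean_succ_cubic {m : ℕ} (hm : 1 ≤ m) (f : SimpleGraph (Fin (m + 2)) → ℝ)
    (a₀ a₁ a₂ a₃ : SimpleGraph (Fin (m + 1)) → ℝ)
    (hf : ∀ G v, f (attach G v) =
      a₀ G + a₁ G * rdeg G v + a₂ G * rdeg G v ^ 2 + a₃ G * rdeg G v ^ 3) :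
    mean (m + 1) f = mean m fun G =>
      a₀ G + (a₁ G * powSum 2 G + a₂ G * powSum 3 G + a₃ G * powSum 4 G) / (2 * m) := by
  rw [mean_succ]
  refine mean_congr m fun G hG => ?_
  have h0 : powSum 1 G ≠ 0 := by
    rw [hG]
    positivity
  simp only [hf]
  rw [sum_parentPMF_mul_cubic G h0, hG]

end Mean

/-! ### Moment recursions -/

section Recursions

theorem powSum_two_attach {n : ℕ} (G : SimpleGraph (Fin n)) (v : Fin n) :
    powSum 2 (attach G v) = powSum 2 G + 2 * rdeg G v + 2 := by
  rw [powSum_attach]; ring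

theorem powSum_three_attach {n : ℕ} (G : SimpleGraph (Fin n)) (v : Fin n) :
    powSum 3 (attach G v) = powSum 3 G + 3 * rdeg G v ^ 2 + 3 * rdeg G v + 2 := by
  rw [powSum_attach]; ring

theorem powSum_four_attach {n : ℕ} (G : SimpleGraph (Fin n)) (v : Fin n) :
    powSum 4 (attach G v) =
      powSum 4 G + 4 * rdeg G v ^ 3 + 6 * rdeg G v ^ 2 + 4 * rdeg G v + 2 := by
  rw [powSum_attach]; ring

/-- The step from zero edges to one falls outside `mean_succ_cubic`, since the degree sum vanishes;
the recursions start from this value. -/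
theorem mean_powSum_two_one : mean 1 (powSum 2) = 2 := by
  have h : ∀ v : Fin 1, powSum 2 (attach (⊥ : SimpleGraph (Fin 1)) v) = 2 := by
    intro v
    rw [powSum_two_attach, rdeg_bot]
    simp [powSum_eq, rdeg_bot]
  rw [mean_succ, mean_zero]
  simp only [h]
  rw [← Finset.sum_mul, sum_parentPMF, one_mul]

variable {m : ℕ}

theorem mean_powSum_two_succ (hm : 1 ≤ m) : mean (m + 1) (powSum 2) =
    (1 + 1 / m) * mean m (powSum 2) + 2 := by
  have hm' : (m : ℝ) ≠ 0 := by positivity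
  calc mean (m + 1) (powSum 2)
      = mean m (fun G => (1 + 1 / m) * powSum 2 G + 2) := by
        rw [mean_succ_cubic hm _ (fun G => powSum 2 G + 2) (fun _ => 2) (fun _ => 0) (fun _ => 0)
          (fun G v => by rw [powSum_two_attach]; ring)]
        congr 1; funext G; field_simp; ring
    _ = _ := by simp only [mean_add, mean_const_mul, mean_const]

theorem mean_powSum_three_succ (hm : 1 ≤ m) : mean (m + 1) (powSum 3) =
    (1 + 3 / (2 * m)) * mean m (powSum 3) + 3 / (2 * m) * mean m (powSum 2) + 2 := by
  have hm' : (m : ℝ) ≠ 0 := by positivity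
  calc mean (m + 1) (powSum 3)
      = mean m (fun G => (1 + 3 / (2 * m)) * powSum 3 G + 3 / (2 * m) * powSum 2 G + 2) := by
        rw [mean_succ_cubic hm _ (fun G => powSum 3 G + 2) (fun _ => 3) (fun _ => 3) (fun _ => 0)
          (fun G v => by rw [powSum_three_attach]; ring)]
        congr 1; funext G; field_simp; ring
    _ = _ := by simp only [mean_add, mean_const_mul, mean_const]

theorem mean_powSum_four_succ (hm : 1 ≤ m) : mean (m + 1) (powSum 4) =
    (1 + 2 / m) * mean m (powSum 4) + 3 / m * mean m (powSum 3) +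
      2 / m * mean m (powSum 2) + 2 := by
  have hm' : (m : ℝ) ≠ 0 := by positivity
  calc mean (m + 1) (powSum 4)
      = mean m (fun G => (1 + 2 / m) * powSum 4 G + 3 / m * powSum 3 G +
          2 / m * powSum 2 G + 2) := by
        rw [mean_succ_cubic hm _ (fun G => powSum 4 G + 2) (fun _ => 4) (fun _ => 6) (fun _ => 4)
          (fun G v => by rw [powSum_four_attach]; ring)]
        congr 1; funext G; field_simp; ring
    _ = _ := by simp only [mean_add, mean_const_mul, mean_const]

theorem mean_sq_succ (hm : 1 ≤ m) : mean (m + 1) (fun G => powSum 2 G ^ 2) =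
    (1 + 2 / m) * mean m (fun G => powSum 2 G ^ 2) + 2 / m * mean m (powSum 3) +
      (4 + 4 / m) * mean m (powSum 2) + 4 := by
  have hm' : (m : ℝ) ≠ 0 := by positivity
  calc mean (m + 1) (fun G => powSum 2 G ^ 2)
      = mean m (fun G => (1 + 2 / m) * powSum 2 G ^ 2 + 2 / m * powSum 3 G +
          (4 + 4 / m) * powSum 2 G + 4) := by
        rw [mean_succ_cubic hm _ (fun G => (powSum 2 G + 2) ^ 2) (fun G => 4 * (powSum 2 G + 2))
          (fun _ => 4) (fun _ => 0) (fun G v => by rw [powSum_two_attach]; ring)]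
        congr 1; funext G; field_simp; ring
    _ = _ := by simp only [mean_add, mean_const_mul, mean_const]

theorem mean_two_mul_three_succ (hm : 1 ≤ m) :
    mean (m + 1) (fun G => powSum 2 G * powSum 3 G) =
    (1 + 5 / (2 * m)) * mean m (fun G => powSum 2 G * powSum 3 G) +
      3 / (2 * m) * mean m (fun G => powSum 2 G ^ 2) + 3 / m * mean m (powSum 4) +
      (2 + 6 / m) * mean m (powSum 3) + (2 + 5 / m) * mean m (powSum 2) + 4 := by
  have hm' : (m : ℝ) ≠ 0 := by positivity
  calc mean (m + 1) (fun G => powSum 2 G * powSum 3 G)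
      = mean m (fun G => (1 + 5 / (2 * m)) * (powSum 2 G * powSum 3 G) +
          3 / (2 * m) * powSum 2 G ^ 2 + 3 / m * powSum 4 G +
          (2 + 6 / m) * powSum 3 G + (2 + 5 / m) * powSum 2 G + 4) := by
        rw [mean_succ_cubic hm _ (fun G => (powSum 2 G + 2) * (powSum 3 G + 2))
          (fun G => 3 * (powSum 2 G + 2) + 2 * (powSum 3 G + 2))
          (fun G => 3 * (powSum 2 G + 2) + 6) (fun _ => 6)
          (fun G v => by rw [powSum_two_attach, powSum_three_attach]; ring)]
        congr 1; funext G; field_simp; ring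
    _ = _ := by simp only [mean_add, mean_const_mul, mean_const]

theorem mean_cube_succ (hm : 1 ≤ m) : mean (m + 1) (fun G => powSum 2 G ^ 3) =
    (1 + 3 / m) * mean m (fun G => powSum 2 G ^ 3) +
      (6 + 12 / m) * mean m (fun G => powSum 2 G ^ 2) +
      6 / m * mean m (fun G => powSum 2 G * powSum 3 G) +
      4 / m * mean m (powSum 4) + 12 / m * mean m (powSum 3) +
      (12 + 12 / m) * mean m (powSum 2) + 8 := by
  have hm' : (m : ℝ) ≠ 0 := by positivity
  calc mean (m + 1) (fun G => powSum 2 G ^ 3)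
      = mean m (fun G => (1 + 3 / m) * powSum 2 G ^ 3 +
          (6 + 12 / m) * powSum 2 G ^ 2 + 6 / m * (powSum 2 G * powSum 3 G) +
          4 / m * powSum 4 G + 12 / m * powSum 3 G + (12 + 12 / m) * powSum 2 G + 8) := by
        rw [mean_succ_cubic hm _ (fun G => (powSum 2 G + 2) ^ 3)
          (fun G => 6 * (powSum 2 G + 2) ^ 2) (fun G => 12 * (powSum 2 G + 2)) (fun _ => 8)
          (fun G v => by rw [powSum_two_attach]; ring)]
        congr 1; funext G; field_simp; ring
    _ = _ := by simp only [mean_add, mean_const_mul, mean_const]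

end Recursions

/-! ### Crude bounds on harmonic numbers -/

section Harmonic

/-- The harmonic numbers as real numbers. -/
def harm (m : ℕ) : ℝ := (harmonic m : ℝ)

theorem harm_succ (m : ℕ) : harm (m + 1) = harm m + 1 / (m + 1) := by
  simp [harm, harmonic_succ]

theorem harm_nonneg (m : ℕ) : 0 ≤ harm m := by
  induction m with
  | zero => simp [harm]
  | succ m ih => rw [harm_succ]; positivity

theorem harm_one : harm 1 = 1 := by simp [harm]

theorem harm_le_self (m : ℕ) : harm m ≤ m := by
  induction m with
  | zero => simp [harm]
  | succ m ih =>
    rw [harm_succ]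
    push_cast
    have : (1 : ℝ) / (m + 1) ≤ 1 := by
      rw [div_le_one (by positivity)]
      linarith [(Nat.cast_nonneg m : (0 : ℝ) ≤ m)]
    linarith

theorem harm_sq_le (m : ℕ) : harm m ^ 2 ≤ 3 * m := by
  induction m with
  | zero => simp [harm]
  | succ m ih =>
    rw [harm_succ]
    push_cast
    have h0 : (0 : ℝ) ≤ m := Nat.cast_nonneg m
    have h1 : (1 : ℝ) / (m + 1) ≤ 1 := by
      rw [div_le_one (by positivity)]
      linarith
    have h2 : (0 : ℝ) ≤ 1 / (m + 1) := by positivity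
    have h3 : harm m * (1 / (m + 1)) ≤ 1 := by
      rw [mul_one_div, div_le_one (by positivity)]
      linarith [harm_le_self m]
    nlinarith

end Harmonic

/-! ### Comparison lemmas for recursions and increments -/

section Growth

/-- A sequence with `x (m+1) ≤ (1 + 5/(2m)) x m + a m²` grows at most like `m³`. -/
theorem le_cube_of_recursion {x : ℕ → ℝ} {a : ℝ} (ha : 0 ≤ a)
    (h : ∀ m : ℕ, 1 ≤ m → x (m + 1) ≤ (1 + 5 / (2 * m)) * x m + a * m ^ 2) :
    ∃ C : ℝ, 0 ≤ C ∧ ∀ m : ℕ, 1 ≤ m → x m ≤ C * m ^ 3 := by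
  -- With `C ≥ 2a` the source costs at most `C m² / 2`, which together with `5/2 · C m²` just fits
  -- into the term `3 C m²` of `C (m+1)³`.
  refine ⟨max (2 * a) (x 1), le_max_of_le_left (by positivity), fun m hm => ?_⟩
  have hC := le_max_left (2 * a) (x 1)
  induction m, hm using Nat.le_induction with
  | base => simp
  | succ m hm ih =>
    generalize max (2 * a) (x 1) = C at *
    have hm' : (1 : ℝ) ≤ m := by exact_mod_cast hm
    have h1 : (1 + 5 / (2 * (m : ℝ))) * x m ≤ (1 + 5 / (2 * m)) * (C * m ^ 3) := by gcongr
    have h2 : (1 + 5 / (2 * (m : ℝ))) * (C * m ^ 3) = C * (m ^ 3 + 5 / 2 * m ^ 2) := by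
      field_simp
    have h3 : a * (m : ℝ) ^ 2 ≤ C / 2 * m ^ 2 := by gcongr; linarith
    push_cast
    have h4 : 0 ≤ C * (3 * (m : ℝ) + 1) := by
      have : 0 ≤ C := by linarith
      positivity
    nlinarith [h m hm]

/-- A sequence with `x (m+1) ≤ (1 + 3/(2m)) x m + a m` grows at most like `m²`. -/
theorem le_sq_of_recursion {x : ℕ → ℝ} {a : ℝ} (ha : 0 ≤ a)
    (h : ∀ m : ℕ, 1 ≤ m → x (m + 1) ≤ (1 + 3 / (2 * m)) * x m + a * m) :
    ∃ C : ℝ, 0 ≤ C ∧ ∀ m : ℕ, 1 ≤ m → x m ≤ C * m ^ 2 := by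
  refine ⟨max (2 * a) (x 1), le_max_of_le_left (by positivity), fun m hm => ?_⟩
  have hC := le_max_left (2 * a) (x 1)
  induction m, hm using Nat.le_induction with
  | base => simp
  | succ m hm ih =>
    generalize max (2 * a) (x 1) = C at *
    have hm' : (1 : ℝ) ≤ m := by exact_mod_cast hm
    have h1 : (1 + 3 / (2 * (m : ℝ))) * x m ≤ (1 + 3 / (2 * m)) * (C * m ^ 2) := by gcongr
    have h2 : (1 + 3 / (2 * (m : ℝ))) * (C * m ^ 2) = C * (m ^ 2 + 3 / 2 * m) := by
      field_simp
    have h3 : a * (m : ℝ) ≤ C / 2 * m := by gcongr; linarith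
    push_cast
    nlinarith [h m hm]

/-- The bound telescopes, as `1/(m(m+1)) = 1/m - 1/(m+1)`. -/
theorem abs_le_of_increment_le {x : ℕ → ℝ} {K : ℝ}
    (h : ∀ m : ℕ, 1 ≤ m → |x (m + 1) - x m| ≤ K / (m * (m + 1))) (m : ℕ) (hm : 1 ≤ m) :
    |x m| ≤ |x 1| + K := by
  have hK : 0 ≤ K := by
    have := (abs_nonneg _).trans (h 1 le_rfl)
    norm_num at this
    linarith
  have key : |x m| ≤ |x 1| + K * (1 - 1 / m) := by
    induction m, hm using Nat.le_induction with
    | base => simp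
    | succ m hm ih =>
      have hm' : (1 : ℝ) ≤ m := by exact_mod_cast hm
      have h1 : |x (m + 1)| ≤ |x m| + |x (m + 1) - x m| := by
        have := abs_add_le (x m) (x (m + 1) - x m)
        rwa [add_sub_cancel] at this
      have h2 : K * (1 - 1 / ((m + 1 : ℕ) : ℝ)) = K * (1 - 1 / m) + K / (m * (m + 1)) := by
        push_cast
        field_simp
        ring
      rw [h2]
      linarith [h m hm]
  have : K * (1 - 1 / (m : ℝ)) ≤ K := by
    have : 0 ≤ K * (1 / (m : ℝ)) := by positivity
    linarith
  linarith

theorem abs_le_harm_of_increment_le {x : ℕ → ℝ} {K : ℝ}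
    (h : ∀ m : ℕ, 1 ≤ m → |x (m + 1) - x m| ≤ K / (m + 1)) (m : ℕ) (hm : 1 ≤ m) :
    |x m| ≤ |x 1| + K * (harm m - 1) := by
  induction m, hm using Nat.le_induction with
  | base => simp [harm_one]
  | succ m hm ih =>
    have h1 : |x (m + 1)| ≤ |x m| + |x (m + 1) - x m| := by
      have := abs_add_le (x m) (x (m + 1) - x m)
      rwa [add_sub_cancel] at this
    have h2 : K * (harm (m + 1) - 1) = K * (harm m - 1) + K / (m + 1) := by
      rw [harm_succ]; ring
    rw [h2]
    linarith [h m hm]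

end Growth

/-! ### Exact mean and crude bounds for the auxiliary moments -/

section MomentBounds

theorem one_le_harm {m : ℕ} (hm : 1 ≤ m) : 1 ≤ harm m := by
  induction m, hm using Nat.le_induction with
  | base => exact harm_one.ge
  | succ m hm ih =>
    rw [harm_succ]
    have : (0 : ℝ) ≤ 1 / (m + 1) := by positivity
    linarith

theorem mean_powSum_two {m : ℕ} (hm : 1 ≤ m) : mean m (powSum 2) = 2 * m * harm m := by
  induction m, hm using Nat.le_induction with
  | base => simp [mean_powSum_two_one, harm_one]
  | succ m hm ih =>
    have hm' : (m : ℝ) ≠ 0 := by positivity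
    rw [mean_powSum_two_succ hm, ih, harm_succ]
    push_cast
    field_simp

theorem exists_mean_powSum_three_le :
    ∃ C : ℝ, 0 ≤ C ∧ ∀ m : ℕ, 1 ≤ m → mean m (powSum 3) ≤ C * m ^ 2 := by
  refine le_sq_of_recursion (a := 5) (by norm_num) fun m hm => ?_
  have hm' : (1 : ℝ) ≤ m := by exact_mod_cast hm
  rw [mean_powSum_three_succ hm, mean_powSum_two hm]
  have h : 3 / (2 * (m : ℝ)) * (2 * m * harm m) = 3 * harm m := by field_simp
  linarith [harm_le_self m]

theorem exists_mean_powSum_four_le :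
    ∃ C : ℝ, 0 ≤ C ∧ ∀ m : ℕ, 1 ≤ m → mean m (powSum 4) ≤ C * m ^ 3 := by
  obtain ⟨C, hC, hs⟩ := exists_mean_powSum_three_le
  refine le_cube_of_recursion (a := 3 * C + 6) (by positivity) fun m hm => ?_
  have hm' : (1 : ℝ) ≤ m := by exact_mod_cast hm
  rw [mean_powSum_four_succ hm, mean_powSum_two hm]
  have h1 : 2 / (m : ℝ) * (2 * m * harm m) = 4 * harm m := by field_simp; ring
  have h2 : 3 / (m : ℝ) * mean m (powSum 3) ≤ 3 / m * (C * m ^ 2) := by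
    gcongr; exact hs m hm
  have h3 : 3 / (m : ℝ) * (C * m ^ 2) = 3 * C * m := by field_simp
  -- The growth factor is relaxed to the one in `le_cube_of_recursion`; the loss is harmless because
  -- `S_4` enters the third moment with weight `4/m`.
  have h4 : (1 + 2 / (m : ℝ)) * mean m (powSum 4) ≤ (1 + 5 / (2 * m)) * mean m (powSum 4) := by
    have := mean_nonneg m _ (powSum_nonneg 4)
    gcongr ?_ * _
    field_simp
    linarith
  have h5 : (3 * C + 6) * (m : ℝ) ≤ (3 * C + 6) * m ^ 2 := by
    gcongr; nlinarith
  nlinarith [harm_le_self m]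

theorem exists_mean_sq_le :
    ∃ C : ℝ, 0 ≤ C ∧ ∀ m : ℕ, 1 ≤ m → mean m (fun G => powSum 2 G ^ 2) ≤ C * m ^ 3 := by
  obtain ⟨C, hC, hs⟩ := exists_mean_powSum_three_le
  refine le_cube_of_recursion (a := 2 * C + 20) (by positivity) fun m hm => ?_
  have hm' : (1 : ℝ) ≤ m := by exact_mod_cast hm
  rw [mean_sq_succ hm, mean_powSum_two hm]
  have h1 : (4 + 4 / (m : ℝ)) * (2 * m * harm m) = 8 * (m + 1) * harm m := by
    field_simp; ring
  have h1' : 8 * ((m : ℝ) + 1) * harm m ≤ 8 * (m + m) * m := by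
    gcongr
    · exact harm_nonneg m
    · exact harm_le_self m
  have h2 : 2 / (m : ℝ) * mean m (powSum 3) ≤ 2 / m * (C * m ^ 2) := by
    gcongr; exact hs m hm
  have h3 : 2 / (m : ℝ) * (C * m ^ 2) = 2 * C * m := by field_simp
  have h4 : (1 + 2 / (m : ℝ)) * mean m (fun G => powSum 2 G ^ 2) ≤
      (1 + 5 / (2 * m)) * mean m (fun G => powSum 2 G ^ 2) := by
    have := mean_nonneg m _ (fun G => sq_nonneg (powSum 2 G))
    gcongr ?_ * _
    field_simp
    linarith
  have h5 : (2 * C) * (m : ℝ) ≤ (2 * C) * m ^ 2 := by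
    gcongr; nlinarith
  nlinarith

theorem exists_mean_two_mul_three_le :
    ∃ C : ℝ, 0 ≤ C ∧ ∀ m : ℕ, 1 ≤ m →
      mean m (fun G => powSum 2 G * powSum 3 G) ≤ C * m ^ 3 := by
  obtain ⟨C₃, hC₃, hs⟩ := exists_mean_powSum_three_le
  obtain ⟨C₄, hC₄, hq⟩ := exists_mean_powSum_four_le
  obtain ⟨B, hB, hb⟩ := exists_mean_sq_le
  refine le_cube_of_recursion (a := 3 / 2 * B + 3 * C₄ + 8 * C₃ + 18) (by positivity)
    fun m hm => ?_
  have hm' : (1 : ℝ) ≤ m := by exact_mod_cast hm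
  rw [mean_two_mul_three_succ hm, mean_powSum_two hm]
  have h1 : (2 + 5 / (m : ℝ)) * (2 * m * harm m) = (4 * m + 10) * harm m := by
    field_simp; ring
  have h1' : (4 * (m : ℝ) + 10) * harm m ≤ (4 * m + 10 * m) * m := by
    gcongr
    · exact harm_nonneg m
    · linarith
    · exact harm_le_self m
  have h2 : (2 + 6 / (m : ℝ)) * mean m (powSum 3) ≤ (2 + 6 / m) * (C₃ * m ^ 2) := by
    gcongr; exact hs m hm
  have h2' : (2 + 6 / (m : ℝ)) * (C₃ * m ^ 2) = C₃ * (2 * m ^ 2 + 6 * m) := by field_simp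
  have h2'' : C₃ * (2 * (m : ℝ) ^ 2 + 6 * m) ≤ C₃ * (8 * m ^ 2) := by
    gcongr; nlinarith
  have h3 : 3 / (m : ℝ) * mean m (powSum 4) ≤ 3 / m * (C₄ * m ^ 3) := by
    gcongr; exact hq m hm
  have h3' : 3 / (m : ℝ) * (C₄ * m ^ 3) = 3 * C₄ * m ^ 2 := by field_simp
  have h4 : 3 / (2 * (m : ℝ)) * mean m (fun G => powSum 2 G ^ 2) ≤
      3 / (2 * m) * (B * m ^ 3) := by
    gcongr; exact hb m hm
  have h4' : 3 / (2 * (m : ℝ)) * (B * m ^ 3) = 3 / 2 * B * m ^ 2 := by field_simp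
  nlinarith

end MomentBounds

/-! ### Sharp asymptotics of the second and third moments -/

section Asymptotics

/-- `E[Z²] = m (m+1) (4 H_m² + O(1))`. -/
theorem exists_abs_mean_sq_sub_le : ∃ K : ℝ, 0 ≤ K ∧ ∀ m : ℕ, 1 ≤ m →
    |mean m (fun G => powSum 2 G ^ 2) - m * (m + 1) * (4 * harm m ^ 2)| ≤
      K * (m * (m + 1)) := by
  obtain ⟨C, hC, hs⟩ := exists_mean_powSum_three_le
  -- Adding `4 S_3` eliminates `S_3` from the recursion: `4(1 + 3/(2m)) + 2/m = 4(1 + 2/m)`.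
  set w : ℕ → ℝ := fun m => mean m (fun G => powSum 2 G ^ 2) + 4 * mean m (powSum 3) with hw
  -- The last term cancels the remaining `4 H_m / ((m+1)(m+2))` in the increment, leaving it free of
  -- harmonic numbers.
  set x : ℕ → ℝ := fun m => w m / (m * (m + 1)) - 4 * harm m ^ 2 + 4 * harm m / (m + 1) with hx
  have hinc : ∀ m : ℕ, 1 ≤ m → |x (m + 1) - x m| ≤ 16 / (m * (m + 1)) := by
    intro m hm
    have hm' : (1 : ℝ) ≤ m := by exact_mod_cast hm
    have h1 : w (m + 1) = (1 + 2 / m) * w m + (8 * m + 20) * harm m + 12 := by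
      simp only [hw]
      rw [mean_sq_succ hm, mean_powSum_three_succ hm, mean_powSum_two hm]
      field_simp
      ring
    have h2 : x (m + 1) - x m = 16 / ((m + 1) * (m + 2)) - 4 / (m + 1) ^ 2 := by
      simp only [hx]
      rw [h1, harm_succ]
      push_cast
      field_simp
      ring
    have h3 : (16 : ℝ) / ((m + 1) * (m + 2)) ≤ 16 / (m * (m + 1)) := by
      gcongr 16 / ?_
      nlinarith
    have h4 : (4 : ℝ) / (m + 1) ^ 2 ≤ 16 / (m * (m + 1)) := by
      gcongr ?_ / ?_
      · norm_num
      · nlinarith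
    have h5 : (0 : ℝ) ≤ 16 / ((m + 1) * (m + 2)) := by positivity
    have h6 : (0 : ℝ) ≤ 4 / (m + 1) ^ 2 := by positivity
    rw [h2, abs_le]
    constructor <;> linarith
  refine ⟨|x 1| + 16 + 4 + 4 * C, by positivity, fun m hm => ?_⟩
  have hm' : (1 : ℝ) ≤ m := by exact_mod_cast hm
  have hxm := abs_le_of_increment_le hinc m hm
  have hid : mean m (fun G => powSum 2 G ^ 2) - m * (m + 1) * (4 * harm m ^ 2) =
      m * (m + 1) * x m - 4 * (m * harm m) - 4 * mean m (powSum 3) := by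
    simp only [hx, hw]
    field_simp
    ring
  have h1 : |m * (m + 1) * x m| ≤ (|x 1| + 16) * (m * (m + 1)) := by
    rw [abs_mul, abs_of_nonneg (by positivity : (0 : ℝ) ≤ m * (m + 1)), mul_comm]
    gcongr
  have h2 : m * harm m ≤ m * (m + 1) := by
    gcongr
    linarith [harm_le_self m]
  have h2' : 0 ≤ m * harm m := mul_nonneg (by positivity) (harm_nonneg m)
  have h3 : mean m (powSum 3) ≤ C * (m * (m + 1)) := by
    refine (hs m hm).trans ?_
    gcongr
    nlinarith
  have h3' := mean_nonneg m _ (powSum_nonneg 3)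
  rw [abs_le] at h1 ⊢
  rw [hid]
  constructor <;> nlinarith

/-- This bounds `m+1` times the increment of the normalized third moment minus `8 H_m^3`. Here `β`
is the error of the second moment and `r` collects the lower-order terms. The bound `h² ≤ 3m` is
what keeps the second fraction bounded; 320 is `288 + 24 + 8`. -/
theorem abs_cube_increment_le {m h K R β r : ℝ} (hm' : 1 ≤ m) (hH : 0 ≤ h) (hH1 : h ≤ m)
    (hH2 : h ^ 2 ≤ 3 * m) (hK : 0 ≤ K) (hR : 0 ≤ R) (hβ1 : |β| ≤ K * (m * (m + 1)))
    (hr0 : 0 ≤ r) (hr1 : r ≤ R * m ^ 2) :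
    |(6 * β + r) / ((m + 2) * (m + 3)) - 24 * h ^ 2 * (4 * m + 6) / ((m + 2) * (m + 3)) -
      24 * h / (m + 1) - 8 / (m + 1) ^ 2| ≤ 6 * K + R + 320 := by
  rw [abs_le] at hβ1
  have f1 : |(6 * β + r) / ((m + 2) * (m + 3))| ≤ 6 * K + R := by
    rw [abs_div, abs_of_nonneg (by positivity : (0 : ℝ) ≤ (m + 2) * (m + 3)),
      div_le_iff₀ (by positivity), abs_le]
    have g1 : K * (m * (m + 1)) ≤ K * ((m + 2) * (m + 3)) := by
      gcongr <;> linarith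
    have g2 : R * m ^ 2 ≤ R * ((m + 2) * (m + 3)) := by
      gcongr; nlinarith
    have g3 : 0 ≤ R * ((m + 2) * (m + 3)) := by positivity
    constructor <;> nlinarith
  have f2 : 24 * h ^ 2 * (4 * m + 6) / ((m + 2) * (m + 3)) ≤ 288 := by
    rw [div_le_iff₀ (by positivity)]
    have : 24 * h ^ 2 * (4 * m + 6) ≤ 24 * (3 * m) * (4 * m + 6) := by gcongr
    nlinarith
  have f2' : 0 ≤ 24 * h ^ 2 * (4 * m + 6) / ((m + 2) * (m + 3)) := by positivity
  have f3 : 24 * h / (m + 1) ≤ 24 := by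
    rw [div_le_iff₀ (by positivity)]
    linarith
  have f3' : 0 ≤ 24 * h / (m + 1) := by positivity
  have f4 : 8 / (m + 1) ^ 2 ≤ 8 := by
    rw [div_le_iff₀ (by positivity)]
    nlinarith
  have f4' : 0 ≤ 8 / (m + 1) ^ 2 := by positivity
  rw [abs_le] at f1 ⊢
  constructor <;> linarith

theorem cube_remainder_le {m h b t q s A B C₃ C₄ : ℝ} (hm' : 1 ≤ m) (hH : 0 ≤ h) (hH1 : h ≤ m)
    (hb : b ≤ B * m ^ 3) (ht : t ≤ A * m ^ 3) (hq : q ≤ C₄ * m ^ 3) (hs0 : 0 ≤ s)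
    (hs : s ≤ C₃ * m ^ 2) :
    12 / m * b + 6 / m * t + 4 / m * q + 12 / m * s + (24 * m + 24) * h + 8 ≤
      (12 * B + 6 * A + 4 * C₄ + 12 * C₃ + 56) * m ^ 2 := by
  have e1 : 12 / m * b ≤ 12 / m * (B * m ^ 3) := by
    gcongr
  have e1' : 12 / m * (B * m ^ 3) = 12 * B * m ^ 2 := by field_simp
  have e2 : 6 / m * t ≤
      6 / m * (A * m ^ 3) := by
    gcongr
  have e2' : 6 / m * (A * m ^ 3) = 6 * A * m ^ 2 := by field_simp
  have e3 : 4 / m * q ≤ 4 / m * (C₄ * m ^ 3) := by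
    gcongr
  have e3' : 4 / m * (C₄ * m ^ 3) = 4 * C₄ * m ^ 2 := by field_simp
  have e4 : 12 / m * s ≤ 12 / 1 * (C₃ * m ^ 2) := by
    gcongr
  have e5 : (24 * m + 24) * h ≤ (24 * m + 24 * m) * m := by
    gcongr
    linarith
  nlinarith

/-- `E[Z³] = m (m+1) (m+2) (8 H_m³ + O(H_m))`. -/
theorem exists_abs_mean_cube_sub_le : ∃ K : ℝ, 0 ≤ K ∧ ∀ m : ℕ, 1 ≤ m →
    |mean m (fun G => powSum 2 G ^ 3) / (m * (m + 1) * (m + 2)) - 8 * harm m ^ 3| ≤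
      K * harm m := by
  obtain ⟨C₃, hC₃, hs⟩ := exists_mean_powSum_three_le
  obtain ⟨C₄, hC₄, hq⟩ := exists_mean_powSum_four_le
  obtain ⟨B, hB, hb⟩ := exists_mean_sq_le
  obtain ⟨A, hA, ht⟩ := exists_mean_two_mul_three_le
  obtain ⟨K, hK, hb'⟩ := exists_abs_mean_sq_sub_le
  set x : ℕ → ℝ := fun m =>
    mean m (fun G => powSum 2 G ^ 3) / (m * (m + 1) * (m + 2)) - 8 * harm m ^ 3 with hx
  set R : ℝ := 12 * B + 6 * A + 4 * C₄ + 12 * C₃ + 56 with hR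
  have hR0 : 0 ≤ R := by positivity
  have hinc : ∀ m : ℕ, 1 ≤ m → |x (m + 1) - x m| ≤ (6 * K + R + 320) / (m + 1) := by
    intro m hm
    have hm' : (1 : ℝ) ≤ m := by exact_mod_cast hm
    have hH := harm_nonneg m
    have hH1 := harm_le_self m
    have hH2 := harm_sq_le m
    set r : ℝ := 12 / m * mean m (fun G => powSum 2 G ^ 2) +
      6 / m * mean m (fun G => powSum 2 G * powSum 3 G) +
      4 / m * mean m (powSum 4) + 12 / m * mean m (powSum 3) +
      (24 * m + 24) * harm m + 8 with hr
    have hr0 : 0 ≤ r := by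
      have e1 := mean_nonneg m _ (fun G => sq_nonneg (powSum 2 G))
      have e2 := mean_nonneg m _ (powSum_nonneg 3)
      have e3 := mean_nonneg m _ (powSum_nonneg 4)
      have e4 := mean_nonneg m _
        (fun G => mul_nonneg (powSum_nonneg 2 G) (powSum_nonneg 3 G))
      positivity
    have hr1 : r ≤ R * m ^ 2 := by
      exact cube_remainder_le hm' hH hH1 (hb m hm) (ht m hm) (hq m hm)
        (mean_nonneg m _ (powSum_nonneg 3)) (hs m hm)
    have hc : mean (m + 1) (fun G => powSum 2 G ^ 3) =
        (1 + 3 / m) * mean m (fun G => powSum 2 G ^ 3) +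
          6 * mean m (fun G => powSum 2 G ^ 2) + r := by
      rw [mean_cube_succ hm, hr, mean_powSum_two hm]
      field_simp
      ring
    set β : ℝ := mean m (fun G => powSum 2 G ^ 2) - m * (m + 1) * (4 * harm m ^ 2) with hβ
    have hβ1 : |β| ≤ K * (m * (m + 1)) := hb' m hm
    -- The main part `4 m (m+1) H_m²` of the second moment, with weight 6, matches the term `24 H_m²
    -- / (m+1)` from the increment of `8 H_m³` up to the factor `m(m+1) - (m+2)(m+3) = -(4m+6)`.
    have hid : x (m + 1) - x m = ((6 * β + r) / ((m + 2) * (m + 3)) -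
        24 * harm m ^ 2 * (4 * m + 6) / ((m + 2) * (m + 3)) -
        24 * harm m / (m + 1) - 8 / (m + 1) ^ 2) / (m + 1) := by
      have hb2 : mean m (fun G => powSum 2 G ^ 2) = β + m * (m + 1) * (4 * harm m ^ 2) := by
        rw [hβ]; ring
      simp only [hx]
      rw [hc, harm_succ, hb2]
      push_cast
      field_simp
      ring
    rw [hid, abs_div, abs_of_nonneg (by positivity : (0 : ℝ) ≤ (m : ℝ) + 1)]
    gcongr
    exact abs_cube_increment_le hm' hH hH1 hH2 hK hR0 hβ1 hr0 hr1
  refine ⟨|x 1| + (6 * K + R + 320), by positivity, fun m hm => ?_⟩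
  refine (abs_le_harm_of_increment_le hinc m hm).trans ?_
  have h1 := one_le_harm hm
  have h2 : |x 1| * 1 ≤ |x 1| * harm m := by gcongr
  have h3 : 0 ≤ 6 * K + R + 320 := by positivity
  linarith

/-- The constant lies between `H_m - log(m+1)` and `H_{m+1} - log(m+1)`, which differ by `1/(m+1)`.
-/
theorem abs_harm_sub_log_le (m : ℕ) :
    |harm m - Real.log (m + 1) - Real.eulerMascheroniConstant| ≤ 1 / (m + 1) := by
  have h1 := Real.eulerMascheroniSeq_lt_eulerMascheroniConstant m
  have h2 := Real.eulerMascheroniConstant_lt_eulerMascheroniSeq' (m + 1)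
  rw [Real.eulerMascheroniSeq] at h1
  rw [Real.eulerMascheroniSeq', if_neg (Nat.succ_ne_zero m)] at h2
  have h3 := harm_succ m
  simp only [harm] at h3 ⊢
  rw [h3] at h2
  push_cast at h2
  rw [abs_le]
  constructor <;> linarith [(by positivity : (0 : ℝ) ≤ 1 / (m + 1))]

theorem half_le_log {m : ℕ} (hm : 1 ≤ m) : 1 / 2 ≤ Real.log (m + 1) := by
  have hm' : (1 : ℝ) ≤ m := by exact_mod_cast hm
  have : Real.log 2 ≤ Real.log (m + 1) := Real.log_le_log (by norm_num) (by linarith)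
  linarith [Real.log_two_gt_d9]

theorem abs_harm_sub_log_le_two (m : ℕ) : |harm m - Real.log (m + 1)| ≤ 2 := by
  have h1 := abs_harm_sub_log_le m
  have h2 : (1 : ℝ) / (m + 1) ≤ 1 := by
    rw [div_le_one (by positivity)]
    linarith [(Nat.cast_nonneg m : (0 : ℝ) ≤ m)]
  have h3 := Real.one_half_lt_eulerMascheroniConstant
  have h4 := Real.eulerMascheroniConstant_lt_two_thirds
  rw [abs_le] at h1 ⊢
  constructor <;> linarith

/-- Expand `(L + g)³` with `L = log(m+1)` and `g = γ + O(1/(m+1))`. The constant is `24 + 96 + 128`,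
the last summand absorbing `8|g|³ ≤ 64` through `L ≥ 1/2`. -/
theorem abs_harm_cube_sub_le {m : ℕ} (hm : 1 ≤ m) :
    |8 * harm m ^ 3 - (8 * Real.log (m + 1) ^ 3 +
      24 * Real.eulerMascheroniConstant * Real.log (m + 1) ^ 2)| ≤
      248 * Real.log (m + 1) := by
  have hL := half_le_log hm
  have hLm : Real.log (m + 1) ≤ m + 1 := (Real.log_le_sub_one_of_pos (by positivity)).trans
    (by linarith)
  have he := abs_harm_sub_log_le m
  have hg := abs_harm_sub_log_le_two m
  set L := Real.log (m + 1) with hLdef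
  set γ := Real.eulerMascheroniConstant
  set g := harm m - L with hgdef
  have hid : 8 * harm m ^ 3 - (8 * L ^ 3 + 24 * γ * L ^ 2) =
      24 * ((g - γ) * L ^ 2) + (24 * g ^ 2 * L + 8 * g ^ 3) := by
    rw [show harm m = L + g by rw [hgdef]; ring]
    ring
  have h1 : |(g - γ) * L ^ 2| ≤ L := by
    rw [abs_mul, abs_of_nonneg (sq_nonneg L)]
    calc |g - γ| * L ^ 2 ≤ 1 / (m + 1) * ((m + 1) * L) := by
          gcongr
          nlinarith
      _ = L := by field_simp
  have hg2 : g ^ 2 ≤ 4 := by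
    rw [abs_le] at hg
    nlinarith
  have h2 : g ^ 2 * L ≤ 4 * L := by gcongr
  have h2' : 0 ≤ g ^ 2 * L := by positivity
  have h3 : |g ^ 3| ≤ 8 := by
    rw [abs_pow]
    calc |g| ^ 3 ≤ 2 ^ 3 := by gcongr
      _ = 8 := by norm_num
  rw [hid]
  rw [abs_le] at h1 h3 ⊢
  constructor <;> linarith

/-- The third moment of the Zagreb index, in terms of the number of edges. -/
theorem exists_abs_mean_cube_sub_log_le : ∃ C : ℝ, ∀ m : ℕ, 1 ≤ m →
    |mean m (fun G => powSum 2 G ^ 3) / (m * (m + 1) * (m + 2)) -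
      (8 * Real.log (m + 1) ^ 3 +
        24 * Real.eulerMascheroniConstant * Real.log (m + 1) ^ 2)| ≤
      C * Real.log (m + 1) := by
  obtain ⟨K, hK, h⟩ := exists_abs_mean_cube_sub_le
  refine ⟨5 * K + 248, fun m hm => ?_⟩
  have h1 := abs_harm_cube_sub_le hm
  have h2 := h m hm
  have h3 : K * harm m ≤ K * (5 * Real.log (m + 1)) := by
    gcongr
    linarith [(abs_le.1 (abs_harm_sub_log_le_two m)).2, half_le_log hm]
  calc _ ≤ _ := abs_sub_le _ (8 * harm m ^ 3) _
    _ ≤ _ := by linarith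

end Asymptotics

/-! ### Moment limits and convergence in mean -/

section Limits

theorem tendsto_log_succ : Tendsto (fun m : ℕ => Real.log (m + 1)) atTop atTop :=
  Real.tendsto_log_atTop.comp (tendsto_atTop_add_const_right _ _ tendsto_natCast_atTop_atTop)

theorem tendsto_div_log_of_bounded {x : ℕ → ℝ} {K : ℝ} (h : ∀ m : ℕ, 1 ≤ m → |x m| ≤ K)
    {k : ℕ} (hk : k ≠ 0) : Tendsto (fun m : ℕ => x m / Real.log (m + 1) ^ k) atTop (𝓝 0) := by
  have h1 : Tendsto (fun m : ℕ => Real.log (m + 1) ^ k) atTop atTop :=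
    (tendsto_pow_atTop hk).comp tendsto_log_succ
  refine squeeze_zero_norm' ?_ (h1.const_div_atTop K)
  filter_upwards [eventually_ge_atTop 1] with m hm
  have hL := half_le_log hm
  rw [norm_div, Real.norm_eq_abs, Real.norm_of_nonneg (by positivity)]
  gcongr
  exact h m hm

theorem tendsto_harm_div_log :
    Tendsto (fun m : ℕ => harm m / Real.log (m + 1)) atTop (𝓝 1) := by
  have h := tendsto_div_log_of_bounded (x := fun m => harm m - Real.log (m + 1)) (K := 2)
    (fun m _ => abs_harm_sub_log_le_two m) one_ne_zero
  have h2 := h.add_const 1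
  rw [zero_add] at h2
  refine h2.congr' ?_
  filter_upwards [eventually_ge_atTop 1] with m hm
  have hL := half_le_log hm
  field_simp
  ring

theorem tendsto_nat_div_succ : Tendsto (fun m : ℕ => (m : ℝ) / (m + 1)) atTop (𝓝 1) :=
  tendsto_natCast_div_add_atTop 1

/-- The normalization of the Zagreb index of a PORT with `m` edges. -/
def scale (m : ℕ) : ℝ := ((m : ℝ) + 1) * Real.log (m + 1)

theorem scale_pos {m : ℕ} (hm : 1 ≤ m) : 0 < scale m := by
  have := half_le_log hm
  unfold scale
  positivity

theorem tendsto_mean_one : Tendsto (fun m : ℕ => mean m (powSum 2) / scale m) atTop (𝓝 2) := by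
  have h := (tendsto_nat_div_succ.mul tendsto_harm_div_log).const_mul 2
  rw [mul_one, mul_one] at h
  refine h.congr' ?_
  filter_upwards [eventually_ge_atTop 1] with m hm
  have hL := half_le_log hm
  rw [mean_powSum_two hm, scale]
  field_simp

theorem tendsto_mean_sq : Tendsto (fun m : ℕ => mean m (fun G => powSum 2 G ^ 2) / scale m ^ 2)
    atTop (𝓝 4) := by
  obtain ⟨K, hK, hb⟩ := exists_abs_mean_sq_sub_le
  set κ : ℕ → ℝ := fun m => (mean m (fun G => powSum 2 G ^ 2) -
    m * (m + 1) * (4 * harm m ^ 2)) / (m * (m + 1)) with hκ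
  have hκ1 : ∀ m : ℕ, 1 ≤ m → |κ m| ≤ K := by
    intro m hm
    have hm' : (1 : ℝ) ≤ m := by exact_mod_cast hm
    rw [hκ, abs_div, abs_of_nonneg (by positivity : (0 : ℝ) ≤ m * (m + 1)),
      div_le_iff₀ (by positivity)]
    exact hb m hm
  have h := tendsto_nat_div_succ.mul (((tendsto_harm_div_log.pow 2).const_mul 4).add
    (tendsto_div_log_of_bounded hκ1 two_ne_zero))
  norm_num at h
  refine h.congr' ?_
  filter_upwards [eventually_ge_atTop 1] with m hm
  have hm' : (1 : ℝ) ≤ m := by exact_mod_cast hm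
  have hL := half_le_log hm
  simp only [hκ, scale]
  field_simp
  ring

theorem tendsto_mean_cube :
    Tendsto (fun m : ℕ => mean m (fun G => powSum 2 G ^ 3) / scale m ^ 3) atTop (𝓝 8) := by
  obtain ⟨K, hK, hc⟩ := exists_abs_mean_cube_sub_le
  -- The error is only `O(H_m)`, so it is divided by `H_m` to become bounded; it returns below as
  -- `(H_m / log) · (ρ / log²)`.
  set ρ : ℕ → ℝ := fun m => (mean m (fun G => powSum 2 G ^ 3) / (m * (m + 1) * (m + 2)) -
    8 * harm m ^ 3) / harm m with hρ
  have hρ1 : ∀ m : ℕ, 1 ≤ m → |ρ m| ≤ K := by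
    intro m hm
    have hH := one_le_harm hm
    rw [hρ, abs_div, abs_of_nonneg (harm_nonneg m), div_le_iff₀ (by positivity)]
    exact hc m hm
  have h1 : Tendsto (fun m : ℕ => ((m : ℝ) + 2) / (m + 1)) atTop (𝓝 1) := by
    have := (tendsto_one_div_add_atTop_nhds_zero_nat (𝕜 := ℝ)).const_add 1
    rw [add_zero] at this
    refine this.congr fun m => ?_
    field_simp
    ring
  have h := (tendsto_nat_div_succ.mul h1).mul (((tendsto_harm_div_log.pow 3).const_mul 8).add
    (tendsto_harm_div_log.mul (tendsto_div_log_of_bounded hρ1 two_ne_zero)))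
  norm_num at h
  refine h.congr' ?_
  filter_upwards [eventually_ge_atTop 1] with m hm
  have hm' : (1 : ℝ) ≤ m := by exact_mod_cast hm
  have hL := half_le_log hm
  have hH := one_le_harm hm
  simp only [hρ, scale]
  field_simp
  ring

/-- The inequality `|x³ - 8| ≤ x³ - 8 + 24 |x - 2|` is needed only for `x ≤ 2`, where `8 - x³ ≤ 12
(2 - x)`; AM-GM then replaces `|x - 2|` by a quadratic. The mean of the right-hand side involves
only the first three moments, so no fourth or higher moment is needed. -/
theorem abs_cube_sub_eight_le {x ε : ℝ} (hx : 0 ≤ x) (hε : 0 < ε) :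
    |x ^ 3 - 8| ≤ x ^ 3 - 8 + 24 * (ε + (x - 2) ^ 2 / (4 * ε)) := by
  have h1 : |x - 2| ≤ ε + (x - 2) ^ 2 / (4 * ε) := by
    rw [← sq_abs (x - 2), ← sub_nonneg]
    have : ε + |x - 2| ^ 2 / (4 * ε) - |x - 2| = (|x - 2| - 2 * ε) ^ 2 / (4 * ε) := by
      field_simp
      ring
    rw [this]
    positivity
  refine le_trans ?_ (add_le_add_right (mul_le_mul_of_nonneg_left h1 (by norm_num)) _)
  rcases le_total 2 x with h | h
  · have : 8 ≤ x ^ 3 := by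
      calc (8 : ℝ) = 2 ^ 3 := by norm_num
        _ ≤ x ^ 3 := by gcongr
    rw [abs_of_nonneg (by linarith)]
    linarith [abs_nonneg (x - 2)]
  · have : x ^ 3 ≤ 8 := by
      calc x ^ 3 ≤ 2 ^ 3 := by gcongr
        _ = 8 := by norm_num
    rw [abs_of_nonpos (by linarith), abs_of_nonpos (by linarith)]
    have : 0 ≤ (2 - x) * (8 - 2 * x - x ^ 2) := mul_nonneg (by linarith) (by nlinarith)
    nlinarith

theorem mean_mono (m : ℕ) {f g : SimpleGraph (Fin (m + 1)) → ℝ} (h : ∀ G, f G ≤ g G) :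
    mean m f ≤ mean m g :=
  Finset.sum_le_sum fun G _ => mul_le_mul_of_nonneg_left (h G) ENNReal.toReal_nonneg

theorem tendsto_mean_abs :
    Tendsto (fun m : ℕ => mean m fun G => |powSum 2 G ^ 3 / scale m ^ 3 - 8|) atTop (𝓝 0) := by
  have hup : ∀ ε : ℝ, 0 < ε → ∀ m : ℕ, 1 ≤ m →
      mean m (fun G => |powSum 2 G ^ 3 / scale m ^ 3 - 8|) ≤
        mean m (fun G => powSum 2 G ^ 3) / scale m ^ 3 - 8 + 24 * (ε +
          (mean m (fun G => powSum 2 G ^ 2) / scale m ^ 2 - 4 * (mean m (powSum 2) / scale m) + 4)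
            / (4 * ε)) := by
    intro ε hε m hm
    have hs := scale_pos hm
    calc _ ≤ mean m (fun G => (1 / scale m ^ 3) * powSum 2 G ^ 3 +
          (6 / (ε * scale m ^ 2)) * powSum 2 G ^ 2 + (-(24 / (ε * scale m))) * powSum 2 G +
          (-8 + 24 * ε + 24 / ε)) := by
          refine mean_mono m fun G => ?_
          have h := abs_cube_sub_eight_le (x := powSum 2 G / scale m)
            (div_nonneg (powSum_nonneg 2 G) hs.le) hε
          rw [div_pow] at h
          refine h.trans (le_of_eq ?_)
          field_simp
          ring
      _ = _ := by
          simp only [mean_add, mean_const_mul, mean_const]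
          field_simp
          ring
  rw [Metric.tendsto_atTop]
  intro δ hδ
  -- With `ε = δ/48` the bound tends to `24 ε = δ/2`, since `4 - 4·2 + 4 = 0`.
  have hlim : Tendsto (fun m : ℕ => mean m (fun G => powSum 2 G ^ 3) / scale m ^ 3 - 8 +
      24 * (δ / 48 + (mean m (fun G => powSum 2 G ^ 2) / scale m ^ 2 -
        4 * (mean m (powSum 2) / scale m) + 4) / (4 * (δ / 48)))) atTop (𝓝 (δ / 2)) := by
    have h := (tendsto_mean_cube.sub_const 8).add ((((((tendsto_mean_sq.sub
      (tendsto_mean_one.const_mul 4)).add_const 4)).div_const (4 * (δ / 48))).const_add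
        (δ / 48)).const_mul 24)
    refine h.trans_eq ?_
    congr 1
    ring
  have hev := (hlim.eventually_lt_const (half_lt_self hδ)).and (eventually_ge_atTop 1)
  obtain ⟨N, hN⟩ := eventually_atTop.1 hev
  refine ⟨N, fun m hm => ?_⟩
  obtain ⟨h1, h2⟩ := hN m hm
  rw [Real.dist_eq, sub_zero, abs_of_nonneg (mean_nonneg m _ fun _ => abs_nonneg _)]
  exact (hup (δ / 48) (by positivity) m h2).trans_lt h1

end Limits

/-! ### Transfer to random trees with the PORT law -/

section Law

theorem measurableSingletonClass_simpleGraph (V : Type*) [Countable V] :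
    MeasurableSingletonClass (SimpleGraph V) where
  measurableSet_singleton G := by
    refine ⟨{G.Adj}, measurableSet_singleton _, ?_⟩
    ext H
    simp

variable {Ω : Type*} [MeasurableSpace Ω] {P : Measure Ω} {m : ℕ}
  {T : Ω → SimpleGraph (Fin (m + 1))}

theorem integrable_comp (hT : HasLaw T (portPMF (m + 1)).toMeasure P)
    (f : SimpleGraph (Fin (m + 1)) → ℝ) :
    Integrable (fun ω => f (T ω)) P := by
  have := measurableSingletonClass_simpleGraph (Fin (m + 1))
  have h : Integrable f (P.map T) := by
    rw [hT.map_eq]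
    exact Integrable.of_finite
  exact h.comp_aemeasurable hT.aemeasurable

theorem integral_comp (hT : HasLaw T (portPMF (m + 1)).toMeasure P)
    (f : SimpleGraph (Fin (m + 1)) → ℝ) :
    ∫ ω, f (T ω) ∂P = mean m f := by
  classical
  have := measurableSingletonClass_simpleGraph (Fin (m + 1))
  have h := hT.integral_comp (f := f) (measurable_of_finite f).aestronglyMeasurable
  rw [Function.comp_def] at h
  rw [h, PMF.integral_eq_sum]
  rfl

end Law

end PORT

end

theorem mainTheorem7 {Ω : Type*} [MeasurableSpace Ω] (P : Measure Ω) [IsProbabilityMeasure P]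
    (T : (n : ℕ) → Ω → SimpleGraph (Fin n))
    (hT : ∀ n : ℕ, 1 ≤ n → HasLaw (T n) (PORT.portPMF n).toMeasure P) :
    (∃ C : ℝ, ∀ n : ℕ, 2 ≤ n →
      Integrable (fun ω => (PORT.zagreb (T n ω) : ℝ) ^ 3) P ∧
      |(∫ ω, (PORT.zagreb (T n ω) : ℝ) ^ 3 ∂P) -
          ((n : ℝ) + 1) * n * ((n : ℝ) - 1) *
            (8 * Real.log n ^ 3 + 24 * Real.eulerMascheroniConstant * Real.log n ^ 2)| ≤
        ((n : ℝ) + 1) * n * ((n : ℝ) - 1) * (C * Real.log n)) ∧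
    Tendsto (fun n : ℕ =>
        eLpNorm (fun ω => (PORT.zagreb (T n ω) : ℝ) ^ 3 / ((n : ℝ) * Real.log n) ^ 3 - 8) 1 P)
      atTop (𝓝 0) := by
  simp only [PORT.cast_zagreb]
  constructor
  · obtain ⟨C, hC⟩ := PORT.exists_abs_mean_cube_sub_log_le
    refine ⟨C, fun n hn => ?_⟩
    obtain ⟨m, rfl⟩ : ∃ m, n = m + 1 := ⟨n - 1, by omega⟩
    have hm : 1 ≤ m := by omega
    have hm' : (1 : ℝ) ≤ m := by exact_mod_cast hm
    have hTm := hT (m + 1) (by omega)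
    refine ⟨PORT.integrable_comp hTm fun G => PORT.powSum 2 G ^ 3, ?_⟩
    rw [PORT.integral_comp hTm fun G => PORT.powSum 2 G ^ 3]
    have h := hC m hm
    push_cast
    set y := 8 * Real.log ((m : ℝ) + 1) ^ 3 +
      24 * Real.eulerMascheroniConstant * Real.log (m + 1) ^ 2
    have hd : ((m : ℝ) + 1 + 1) * (m + 1) * (m + 1 - 1) = m * (m + 1) * (m + 2) := by ring
    have hid : PORT.mean m (fun G => PORT.powSum 2 G ^ 3) - m * (m + 1) * (m + 2) * y =
        m * (m + 1) * (m + 2) *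
          (PORT.mean m (fun G => PORT.powSum 2 G ^ 3) / (m * (m + 1) * (m + 2)) - y) := by
      field_simp
    rw [hd, hid, abs_mul, abs_of_nonneg (by positivity : (0 : ℝ) ≤ m * (m + 1) * (m + 2))]
    gcongr
  -- The shift `n = m + 1` passes from vertices to edges, and the `L_1` norm becomes the mean of an
  -- absolute value.
  · rw [← tendsto_add_atTop_iff_nat 1]
    have h := ENNReal.tendsto_ofReal PORT.tendsto_mean_abs
    rw [ENNReal.ofReal_zero] at h
    refine h.congr fun m => ?_
    have hTm := hT (m + 1) (by omega)
    rw [← PORT.integral_comp hTm, eLpNorm_one_eq_lintegral_enorm,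
      ← ofReal_integral_norm_eq_lintegral_enorm (PORT.integrable_comp hTm fun G =>
        PORT.powSum 2 G ^ 3 / (((m + 1 : ℕ) : ℝ) * Real.log ((m + 1 : ℕ) : ℝ)) ^ 3 - 8)]
    simp only [Real.norm_eq_abs, PORT.scale, Nat.cast_add, Nat.cast_one]
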